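/- Let $X$ be a normal projective variety of dimension at least $2$ over a finite field $\mathbb{F}_q$ (an integral normal closed subscheme of some $\mathbb{P}^m_{\mathbb{F}_q}$), let $\mathcal{S} \subseteq X(\mathbb{F}_q)$ be a set of $\mathbb{F}_q$-rational points, and let $C_1, \dots, C_a$ be irreducible curves on $X$ defined over $\mathbb{F}_q$ (integral closed subschemes of dimension $1$) such that $\mathcal{S} \subseteq \bigcup_{i=1}^a C_i$ and $\#(C_i \cap \mathcal{S}) \le N$ for all $i$. Let $\mathcal{L}$ be a line bundle on $X$ defined over $\mathbb{F}_q$ such that $$0 \le \mathcal{L}\cdot C_i \le \eta \le N \quad \text{for all } i,$$ where $\mathcal{L}\cdot C_i$ is the degree over $\mathbb{F}_q$ of $\mathcal{L}|_{C_i}$, that is, the common degree $\sum_p \operatorname{ord}_p(s)\,[\kappa(p):\mathbb{F}_q]$ of the divisors of the nonzero rational sections $s$ of $\mathcal{L}|_{C_i}$. Suppose $\Gamma(X,\mathcal{L}) \ne 0$ and let $$\ell = \max_{0 \ne f \in \Gamma(X,\mathcal{L})} \#\{i : C_i \subseteq Z(f)\},$$ where $Z(f)$ is the zero locus of $f$.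 Let $C(X,\mathcal{L};\mathcal{S}) \subseteq \mathbb{F}_q^{\mathcal{S}}$ be the image of the linear map $\Gamma(X,\mathcal{L}) \to \mathbb{F}_q^{\mathcal{S}}$ that sends $f$ to the vector of its values at the points $P \in \mathcal{S}$ with respect to chosen local trivializations of $\mathcal{L}$ at these points. If this code is nonzero, then, for every choice of the trivializations, its minimum distance $d$ satisfies $$d \ge \#\mathcal{S} - \ell N - (a - \ell)\eta.$$ -/

import Mathlib

open AlgebraicGeometry CategoryTheory TopologicalSpace

universe u

namespace CurveCode

noncomputable section

/-! ### Projective and normal schemes over a field -/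

attribute [local instance] MvPolynomial.gradedAlgebra

/-- The projective space `ℙ^m` over a field `k`. -/
abbrev ProjSpace (k : Type u) [Field k] (m : ℕ) : Scheme.{u} :=
  Proj (MvPolynomial.homogeneousSubmodule (Fin (m + 1)) k)

/-- The structure morphism `ℙ^m ⟶ Spec k`. -/
def projSpaceHom (k : Type u) [Field k] (m : ℕ) : ProjSpace k m ⟶ Spec (CommRingCat.of k) :=
  Proj.toSpecZero (MvPolynomial.homogeneousSubmodule (Fin (m + 1)) k) ≫
    Spec.map (CommRingCat.ofHom
      (algebraMap k (MvPolynomial.homogeneousSubmodule (Fin (m + 1)) k 0)))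

/-- A `k`-scheme `π : X ⟶ Spec k` is projective if it is isomorphic over `k` to a closed subscheme
of some projective space `ℙ^m`. -/
class IsProjective {k : Type u} [Field k] {X : Scheme.{u}} (π : X ⟶ Spec (CommRingCat.of k)) :
    Prop where
  exists_closedImmersion : ∃ (m : ℕ) (j : X ⟶ ProjSpace k m),
    IsClosedImmersion j ∧ j ≫ projSpaceHom k m = π

/-- A scheme is normal if its local rings are integrally closed domains. -/
class IsNormal (X : Scheme.{u}) : Prop where
  isDomain_stalk : ∀ x : X, IsDomain (X.presheaf.stalk x)
  isIntegrallyClosed_stalk : ∀ x : X, IsIntegrallyClosed (X.presheaf.stalk x)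

theorem isLocallyNoetherian_projSpace (k : Type u) [Field k] (m : ℕ) :
    IsLocallyNoetherian (ProjSpace k m) := by
  let A := MvPolynomial.homogeneousSubmodule (Fin (m + 1)) k
  have : IsScalarTower k (A 0) (MvPolynomial (Fin (m + 1)) k) :=
    ⟨fun c x y ↦ smul_mul_assoc c (x : MvPolynomial (Fin (m + 1)) k) y⟩
  have : Algebra.FiniteType (A 0) (MvPolynomial (Fin (m + 1)) k) :=
    Algebra.FiniteType.of_restrictScalars_finiteType k (A 0) _
  have hsurj : Function.Surjective (algebraMap k (A 0)) := by
    rintro ⟨p, hp⟩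
    refine ⟨p.coeff 0, Subtype.ext ?_⟩
    exact (MvPolynomial.totalDegree_eq_zero_iff_eq_C.mp
      (Nat.le_zero.mp (MvPolynomial.IsHomogeneous.totalDegree_le hp))).symm
  have : IsNoetherianRing (A 0) := isNoetherianRing_of_surjective _ _ _ hsurj
  exact LocallyOfFiniteType.isLocallyNoetherian (Proj.toSpecZero A)

theorem IsProjective.isLocallyNoetherian {k : Type u} [Field k] {X : Scheme.{u}}
    (π : X ⟶ Spec (CommRingCat.of k)) [h : IsProjective π] : IsLocallyNoetherian X := by
  obtain ⟨m, j, hj, -⟩ := h.exists_closedImmersion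
  have := isLocallyNoetherian_projSpace k m
  exact LocallyOfFiniteType.isLocallyNoetherian j

/-! ### Line bundles and their sections -/

section LineBundle

variable {X : Scheme.{u}}

/-- Restriction of sections of an `𝒪_X`-module. -/
def res (M : X.Modules) {U V : X.Opens} (h : V ≤ U) (s : Γ(M, U)) : Γ(M, V) :=
  M.presheaf.map (homOfLE h).op s

/-- A local trivialization of `M` at the point `x`: an open neighbourhood `U` of `x` and a section
`e` of `M` over `U` such that `r ↦ r • e` is an isomorphism `𝒪_U ≅ M|_U`. -/
structure LocalTriv (M : X.Modules) (x : X) where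
  U : X.Opens
  mem : x ∈ U
  e : Γ(M, U)
  bijective : ∀ (V : X.Opens) (h : V ≤ U),
    Function.Bijective (fun r : Γ(X, V) ↦ (r • res M h e : Γ(M, V)))

/-- A line bundle is a locally free sheaf of rank one. -/
def IsLineBundle (M : X.Modules) : Prop :=
  ∀ x : X, Nonempty (LocalTriv M x)

namespace LocalTriv

variable {M : X.Modules} {x : X}

/-- For `V ⊆ U` the isomorphism `M(V) ≅ 𝒪_X(V)` given by a local trivialization on `U`:
`s ↦ g`, where `s = g • e`. -/
def coord (t : LocalTriv M x) {V : X.Opens} (h : V ≤ t.U) (s : Γ(M, V)) : Γ(X, V) :=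
  (Equiv.ofBijective _ (t.bijective V h)).symm s

theorem coord_smul (t : LocalTriv M x) {V : X.Opens} (h : V ≤ t.U) (s : Γ(M, V)) :
    t.coord h s • res M h t.e = s :=
  (Equiv.ofBijective _ (t.bijective V h)).apply_symm_apply s

theorem coord_eq (t : LocalTriv M x) {V : X.Opens} (h : V ≤ t.U) {s : Γ(M, V)} {g : Γ(X, V)}
    (hg : g • res M h t.e = s) : t.coord h s = g :=
  (t.bijective V h).1 ((t.coord_smul h s).trans hg.symm)

/-- The value at `x`, in the residue field `κ(x)`, of a global section of `M` with respect to a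
local trivialization at `x`. -/
def value (t : LocalTriv M x) (f : Γ(M, ⊤)) : X.residueField x :=
  X.evaluation t.U x t.mem (t.coord le_rfl (res M le_top f))

end LocalTriv

/-- The set of zeros `Z(f)` of a global section `f` of a line bundle. -/
def zeroLocus (M : X.Modules) (f : Γ(M, ⊤)) : Set X :=
  {x | ∀ t : LocalTriv M x, t.value f = 0}

end LineBundle

/-! ### Degrees of line bundles on curves and intersection numbers -/

section Degree

variable {C : Scheme.{u}} [IsIntegral C]

/-- A nonzero rational section of a line bundle `M` on an integral scheme `C`: a nonzero section
of `M` over a nonempty open subset. -/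
structure RatSection (M : C.Modules) where
  V : C.Opens
  nonempty : (V : Set C).Nonempty
  s : Γ(M, V)
  ne_zero : s ≠ 0

theorem RatSection.genericPoint_mem {M : C.Modules} (s : RatSection M) {p : C}
    (t : LocalTriv M p) : genericPoint C ∈ t.U ⊓ s.V :=
  ⟨((genericPoint_spec C).mem_open_set_iff t.U.isOpen).mpr ⟨p, trivial, t.mem⟩,
    ((genericPoint_spec C).mem_open_set_iff s.V.isOpen).mpr
      (by simpa using s.nonempty)⟩

/-- The rational function on `C` that represents a rational section in a local trivialization. -/
def RatSection.localFunction {M : C.Modules} (s : RatSection M) {p : C} (t : LocalTriv M p) :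
    C.functionField :=
  C.presheaf.germ (t.U ⊓ s.V) (genericPoint C) (s.genericPoint_mem t)
    (t.coord inf_le_left (res M inf_le_right s.s))

open Classical in
/-- The order of vanishing at `p` of a nonzero rational section of a line bundle: the order of the
rational function representing it in a local trivialization at `p`. (It does not depend on the
trivialization; on a line bundle the second case does not occur.) -/
def RatSection.ordAt [IsLocallyNoetherian C] {M : C.Modules} (s : RatSection M) (p : C) : ℤ :=
  if h : Nonempty (LocalTriv M p) then Scheme.ord (s.localFunction h.some) p else 0

/-- The degree `∑_p ord_p(s) [κ(p) : k]` of the divisor of a nonzero rational section of a line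
bundle on an integral curve `C` over `k`. -/
def RatSection.degree {k : Type u} [Field k] [IsLocallyNoetherian C]
    (π : C ⟶ Spec (CommRingCat.of k)) {M : C.Modules} (s : RatSection M) : ℤ :=
  ∑ᶠ p : C, s.ordAt p * (π.residueDegree p : ℤ)

/-- The degree of a line bundle on a projective integral curve over `k`, that is, the degree of
the divisors of its nonzero rational sections. All these divisors have the same degree, so that
the supremum is over a one-element set of integers. -/
def degree {k : Type u} [Field k] [IsLocallyNoetherian C] (π : C ⟶ Spec (CommRingCat.of k))
    (M : C.Modules) : EReal :=
  ⨆ s : RatSection M, (((s.degree π : ℤ) : ℝ) : EReal)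

end Degree

/-- An irreducible curve on `X`: a closed integral subscheme of dimension one. -/
structure Curve (X : Scheme.{u}) where
  C : Scheme.{u}
  ι : C ⟶ X
  isClosedImmersion : IsClosedImmersion ι
  isIntegral : IsIntegral C
  dim_eq_one : topologicalKrullDim C = 1

/-- The set of points of a curve on `X`. -/
def Curve.support {X : Scheme.{u}} (C : Curve X) : Set X := Set.range C.ι

theorem Curve.isLocallyNoetherian {X : Scheme.{u}} (C : Curve X) [IsLocallyNoetherian X] :
    IsLocallyNoetherian C.C :=
  have := C.isClosedImmersion
  LocallyOfFiniteType.isLocallyNoetherian C.ι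

/-- The intersection number `L · C` of a line bundle `L` and a curve `C` on a projective
`k`-scheme: the degree over `k` of the line bundle `L|_C`. -/
def intersectionNumber {k : Type u} [Field k] {X : Scheme.{u}} (π : X ⟶ Spec (CommRingCat.of k))
    [IsProjective π] (L : X.Modules) (C : Curve X) : EReal :=
  haveI := C.isIntegral
  haveI := IsProjective.isLocallyNoetherian π
  haveI := C.isLocallyNoetherian
  degree (C.ι ≫ π) ((Scheme.Modules.pullback C.ι).obj L)

/-! ### The code `C(X, L; S)` -/

section Code

variable {k : Type u} [Field k] {X : Scheme.{u}} (π : X ⟶ Spec (CommRingCat.of k))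

/-- The constants as functions on `X`. -/
def constFun : k →+* Γ(X, ⊤) :=
  ((Scheme.ΓSpecIso (CommRingCat.of k)).inv ≫ π.appTop).hom

/-- The inclusion of `k` in the residue field of a point of `X`. -/
def constAt (P : X) : k →+* X.residueField P :=
  (X.evaluation ⊤ P trivial).hom.comp (constFun π)

/-- The set `X(k)` of `k`-rational points: the points with residue field `k`. -/
def rationalPoints : Set X := {P | Function.Bijective (constAt π P)}

/-- For a rational point `P`, the identification of the residue field with `k`. -/
def toBase {P : X} (hP : P ∈ rationalPoints π) : X.residueField P ≃+* k :=
  (RingEquiv.ofBijective (constAt π P) hP).symm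

/-- The germ map `Γ(X, L) → k^S` defined by local trivializations of `L` at the points of `S`. -/
def germMap (L : X.Modules) (S : Finset X) (hS : (S : Set X) ⊆ rationalPoints π)
    (t : ∀ P : S, LocalTriv L P.1) (f : Γ(L, ⊤)) : S → k :=
  fun P ↦ toBase π (hS P.2) ((t P).value f)

theorem LocalTriv.value_add {M : X.Modules} {x : X} (t : LocalTriv M x) (f g : Γ(M, ⊤)) :
    t.value (f + g) = t.value f + t.value g := by
  unfold LocalTriv.value
  rw [← map_add]
  congr 1
  apply t.coord_eq
  rw [add_smul, t.coord_smul, t.coord_smul]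
  exact (map_add (M.presheaf.map (homOfLE le_top).op).hom f g).symm

theorem LocalTriv.value_smul {M : X.Modules} {x : X} (t : LocalTriv M x) (r : Γ(X, ⊤))
    (f : Γ(M, ⊤)) : t.value (r • f) = X.evaluation ⊤ x trivial r * t.value f := by
  unfold LocalTriv.value
  have h : X.evaluation ⊤ x trivial r
      = X.evaluation t.U x t.mem (X.presheaf.map (homOfLE le_top).op r) := by
    simp only [Scheme.evaluation, CommRingCat.comp_apply]
    rw [TopCat.Presheaf.germ_res_apply]
  rw [h, ← map_mul]
  congr 1
  apply t.coord_eq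
  rw [mul_smul, t.coord_smul]
  exact (M.map_smul (homOfLE le_top) r f).symm

/-- The code `C(X, L; S)`: the image of the germ map, a linear code in `k^S`. -/
def code (L : X.Modules) (S : Finset X) (hS : (S : Set X) ⊆ rationalPoints π)
    (t : ∀ P : S, LocalTriv L P.1) : Submodule k (S → k) where
  carrier := Set.range (germMap π L S hS t)
  add_mem' := by
    rintro _ _ ⟨f, rfl⟩ ⟨g, rfl⟩
    exact ⟨f + g, funext fun P ↦ by simp [germMap, LocalTriv.value_add]⟩
  zero_mem' := by
    refine ⟨(0 : Γ(X, ⊤)) • (0 : Γ(L, ⊤)), funext fun P ↦ ?_⟩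
    simp only [germMap, LocalTriv.value_smul, map_zero, zero_mul, Pi.zero_apply]
  smul_mem' := by
    rintro c _ ⟨f, rfl⟩
    refine ⟨constFun π c • f, funext fun P ↦ ?_⟩
    simp only [germMap, LocalTriv.value_smul, map_mul, Pi.smul_apply, smul_eq_mul]
    congr 1
    exact (RingEquiv.ofBijective (constAt π P.1) (hS P.2)).symm_apply_apply c

open Classical in
/-- `d` is the minimum distance of the linear code `C`: the least Hamming distance between two
different codewords. (The zero code has no minimum distance.) -/
def IsMinDist {ι : Type*} [Fintype ι] (C : Submodule k (ι → k)) (d : ℕ) : Prop :=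
  IsLeast {w | ∃ c ∈ C, ∃ c' ∈ C, c ≠ c' ∧ hammingDist c c' = w} d

end Code

end

end CurveCode

/-! Two distinct codewords differ by the values of a nonzero section `f`, and their distance is `#S
- #Z`, where `Z` is the set of points of `S` at which `f` vanishes. The curves cover `Z`. At most
`ℓ` of them lie in `Z(f)`, and each of these meets `Z` in at most `N` points. Any other curve meets
`Z` in at most `L · C_i ≤ η` points (`card_zeros_le_intersectionNumber`). Since `η ≤ N`, the bound
is worst with `ℓ` curves of the first kind, so `#Z ≤ ℓN + (a - ℓ)η`.

For the count on one curve, `f` pulls back to a nonzero section of the restricted line bundle. Its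
orders are nonnegative, and at least `1` at each rational zero, which is a closed point of positive
residue degree. This rests on two facts: trivializations pull back to trivializations
(`IsGenerator.pullback`), and the divisor of a global section has finite support
(`finite_support_ordAt`). -/

namespace CurveCode

noncomputable section

/-! ### Generating sections and their pullback -/

section Triv

variable {X : Scheme.{u}}

theorem res_self (M : X.Modules) {U : X.Opens} (h : U ≤ U) (s : Γ(M, U)) : res M h s = s := by
  change M.presheaf.map (𝟙 _) s = s
  simp

theorem res_res (M : X.Modules) {U V W : X.Opens} (h : V ≤ U) (h' : W ≤ V) (s : Γ(M, U)) :
    res M h' (res M h s) = res M (h'.trans h) s := by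
  change (M.presheaf.map _ ≫ M.presheaf.map _) s = _
  rw [← M.presheaf.map_comp]; rfl

theorem res_smul (M : X.Modules) {U V : X.Opens} (h : V ≤ U) (r : Γ(X, U)) (s : Γ(M, U)) :
    res M h (r • s) = X.presheaf.map (homOfLE h).op r • res M h s :=
  M.map_smul (homOfLE h) r s

theorem res_zero (M : X.Modules) {U V : X.Opens} (h : V ≤ U) :
    res M h (0 : Γ(M, U)) = 0 := map_zero (M.presheaf.map (homOfLE h).op).hom

theorem app_res {M N : X.Modules} (φ : M ⟶ N) {U V : X.Opens} (h : V ≤ U) (s : Γ(M, U)) :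
    φ.app V (res M h s) = res N h (φ.app U s) :=
  ConcreteCategory.congr_hom (φ.mapPresheaf.naturality (homOfLE h).op) s

/-- The structure sheaf as a module over itself. -/
abbrev structureModule (X : Scheme.{u}) : X.Modules := SheafOfModules.unit X.ringCatSheaf

theorem app_structureModule {M : X.Modules} (φ : structureModule X ⟶ M) (U : X.Opens)
    (r : Γ(X, U)) :
    φ.app U r = r • res M le_top (φ.app ⊤ (1 : Γ(X, ⊤))) := by
  have h1 : r = r • (res (structureModule X) le_top (1 : Γ(X, ⊤)) : Γ(structureModule X, U)) := by
    exact ((congrArg (fun s : Γ(X, U) ↦ r * s) (map_one (X.presheaf.map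
      (homOfLE (le_top : U ≤ ⊤)).op).hom)).trans (mul_one r)).symm
  refine (congrArg (φ.app U) h1).trans ((φ.app_smul r _).trans ?_)
  exact congrArg (fun s ↦ r • s) (app_res φ le_top _)

/-- The structure sheaf is free on the section `1`, so it corepresents global sections. -/
theorem bijective_app_one (M : X.Modules) :
    Function.Bijective (fun φ : structureModule X ⟶ M ↦ (φ.app ⊤ (1 : Γ(X, ⊤)) : Γ(M, ⊤))) := by
  constructor
  · intro φ ψ h
    ext U r
    exact (app_structureModule φ U r).trans
      ((congrArg (fun s ↦ (show Γ(X, U) from r) • res M le_top s) h).trans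
        (app_structureModule ψ U r).symm)
  · intro s
    let s' : M.val.sections := PresheafOfModules.sectionsMk
      (fun U ↦ (res M (U := ⊤) (V := U.unop) le_top s : Γ(M, U.unop)))
      (fun U V f ↦ res_res M le_top f.unop.le s)
    refine ⟨(SheafOfModules.unitHomEquiv M).symm s', ?_⟩
    have := congrArg (fun t ↦ t.val (.op ⊤)) ((SheafOfModules.unitHomEquiv M).apply_symm_apply s')
    exact this.trans (res_self M le_rfl s)

/-- A section that generates `M` over `U`. -/
def IsGenerator (M : X.Modules) {U : X.Opens} (e : Γ(M, U)) : Prop :=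
  ∀ (V : X.Opens) (h : V ≤ U),
    Function.Bijective (fun r : Γ(X, V) ↦ (r • res M h e : Γ(M, V)))

theorem isGenerator_iff_isIso (M : X.Modules) (φ : structureModule X ⟶ M) :
    IsGenerator M (U := ⊤) (φ.app ⊤ (1 : Γ(X, ⊤))) ↔ IsIso φ := by
  rw [Scheme.Modules.Hom.isIso_iff_isIso_app]
  refine ⟨fun h U ↦ ?_, fun h U hU ↦ ?_⟩
  · rw [ConcreteCategory.isIso_iff_bijective]
    convert! h U le_top using 1
    ext r
    exact app_structureModule φ U r
  · have := (ConcreteCategory.isIso_iff_bijective _).mp (h U)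
    convert! this using 1
    ext r
    exact (app_structureModule φ U r).symm

theorem isGenerator_iff_restrict (M : X.Modules) {U : X.Opens} (e : Γ(M, U)) :
    IsGenerator M e ↔ IsGenerator (M.restrict U.ι) (U := ⊤)
      (res M (U := U) (V := U.ι ''ᵁ ⊤) (by simp) e) := by
  have key (V' : U.toScheme.Opens) (h1 : U.ι ''ᵁ V' ≤ U) :
      (fun r : Γ(U, V') ↦ (r • res (M.restrict U.ι) le_top
        (res M (U := U) (V := U.ι ''ᵁ ⊤) (by simp) e) : Γ(M.restrict U.ι, V'))) =
      (fun r : Γ(X, U.ι ''ᵁ V') ↦ (r • res M h1 e : Γ(M, U.ι ''ᵁ V'))) ∘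
        (U.ι.appIso V').inv := by
    ext r
    refine (Scheme.Modules.smul_restrictAppIso_hom_apply U.ι M V' r _).trans ?_
    exact congrArg (fun s : Γ(M, U.ι ''ᵁ V') ↦ (U.ι.appIso V').inv r • s)
      (res_res M (by simp) (Scheme.Hom.image_mono U.ι le_top) e)
  have hb (V' : U.toScheme.Opens) : Function.Bijective (U.ι.appIso V').inv :=
    (ConcreteCategory.isIso_iff_bijective _).mp inferInstance
  refine ⟨fun h V' hV' ↦ ?_, fun h V hV ↦ ?_⟩
  · have h1 : U.ι ''ᵁ V' ≤ U := by simpa using Scheme.Hom.image_mono U.ι hV'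
    rw [key V' h1]
    exact (h _ h1).comp (hb V')
  · obtain ⟨V', rfl⟩ : ∃ V', V = U.ι ''ᵁ V' :=
      ⟨U.ι ⁻¹ᵁ V, by simpa [Scheme.Hom.image_preimage_eq_opensRange_inf] using hV⟩
    have := h V' le_top
    rw [key V' hV] at this
    exact (Function.Bijective.of_comp_iff _ (hb V')).mp this

theorem res_restrict (M : X.Modules) {U : X.Opens} (e : Γ(M, U)) :
    res (M.restrict U.ι) (le_top : U.ι ⁻¹ᵁ U ≤ ⊤)
      (res M (U := U) (V := U.ι ''ᵁ ⊤) (by simp) e) = res M (U.ι.image_preimage_le U) e :=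
  res_res M (by simp) (Scheme.Hom.image_mono U.ι le_top) e

theorem app_res_restrict {M : X.Modules} {U : X.Opens} {K : U.toScheme.Modules}
    (ψ : M.restrict U.ι ⟶ K) (e : Γ(M, U)) :
    ((Scheme.Modules.restrictAdjunction U.ι).homEquiv M K ψ).app U e = ψ.app (U.ι ⁻¹ᵁ U)
      (res (M.restrict U.ι) le_top (res M (U := U) (V := U.ι ''ᵁ ⊤) (by simp) e)) := by
  rw [res_restrict, Adjunction.homEquiv_unit]
  rfl

/-- By Yoneda, `𝒪_U ⟶ M|_U` is an isomorphism iff precomposition with it is bijective for every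
target `K`; the restriction adjunction then replaces `M|_U ⟶ K` by `M ⟶ ι_* K`. This form mentions
only morphisms out of `M`, so it can cross the pullback-pushforward adjunction. -/
theorem isGenerator_iff_bijective (M : X.Modules) {U : X.Opens} (e : Γ(M, U)) :
    IsGenerator M e ↔ ∀ K : U.toScheme.Modules, Function.Bijective
      (fun χ : M ⟶ (Scheme.Modules.pushforward U.ι).obj K ↦ χ.app U e) := by
  rw [isGenerator_iff_restrict]
  obtain ⟨φ, hφ⟩ := (bijective_app_one (M.restrict U.ι)).2
    (res M (U := U) (V := U.ι ''ᵁ ⊤) (by simp) e)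
  dsimp only at hφ
  rw [← hφ, isGenerator_iff_isIso, isIso_iff_coyoneda_map_bijective]
  refine forall_congr' fun K ↦ ?_
  -- `U.ι ⁻¹ᵁ U` and `⊤` are equal opens but not definitionally; restriction between them is
  -- harmless.
  have h1 : Function.Bijective (res K (le_top : U.ι ⁻¹ᵁ U ≤ ⊤)) := by
    refine (ConcreteCategory.isIso_iff_bijective (K.presheaf.map (homOfLE le_top).op)).mp ?_
    have : IsIso (homOfLE (le_top : U.ι ⁻¹ᵁ U ≤ ⊤)) := ⟨homOfLE (by simp), rfl, rfl⟩
    infer_instance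
  rw [← (bijective_app_one K).of_comp_iff', ← h1.of_comp_iff',
    ← Function.Bijective.of_comp_iff _
      ((Scheme.Modules.restrictAdjunction U.ι).homEquiv M K).bijective]
  refine iff_of_eq (congrArg _ (funext fun ψ ↦ ?_))
  have h2 : res K (le_top : U.ι ⁻¹ᵁ U ≤ ⊤) ((φ ≫ ψ).app ⊤ (1 : Γ(U, ⊤))) =
      res K le_top (ψ.app ⊤ (res M (U := U) (V := U.ι ''ᵁ ⊤) (by simp) e)) :=
    congrArg (fun s ↦ res K le_top (ψ.app ⊤ s)) hφ
  have h3 := app_res ψ (le_top : U.ι ⁻¹ᵁ U ≤ ⊤) (res M (U := U) (V := U.ι ''ᵁ ⊤) (by simp) e)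
  exact h2.trans (h3.symm.trans (app_res_restrict ψ e).symm)

/-- The pullback of a section. -/
def pullbackSection {Y : Scheme.{u}} (f : Y ⟶ X) (M : X.Modules) {U : X.Opens} (s : Γ(M, U)) :
    Γ((Scheme.Modules.pullback f).obj M, f ⁻¹ᵁ U) :=
  ((Scheme.Modules.pullbackPushforwardAdjunction f).unit.app M).app U s

/-- With `V = f⁻¹ U`, morphisms `f^* M ⟶ (V.ι)_* N` are morphisms `M ⟶ f_* (V.ι)_* N`, and `f ∘ V.ι
= U.ι ∘ f|_U` rewrites the target as `(U.ι)_* (f|_U)_* N`, where the universal property of `e`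
applies. -/
theorem IsGenerator.pullback {Y : Scheme.{u}} (f : Y ⟶ X) {M : X.Modules} {U : X.Opens}
    {e : Γ(M, U)} (he : IsGenerator M e) : IsGenerator _ (pullbackSection f M e) := by
  rw [isGenerator_iff_bijective] at he ⊢
  intro N
  let V := f ⁻¹ᵁ U
  let α : (Scheme.Modules.pushforward f).obj ((Scheme.Modules.pushforward V.ι).obj N) ≅
      (Scheme.Modules.pushforward U.ι).obj ((Scheme.Modules.pushforward (f ∣_ U)).obj N) :=
    (Scheme.Modules.pushforwardComp V.ι f ≪≫
      Scheme.Modules.pushforwardCongr (morphismRestrict_ι f U).symm ≪≫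
      (Scheme.Modules.pushforwardComp (f ∣_ U) U.ι).symm).app N
  have hα : Function.Bijective (α.hom.app U) :=
    (ConcreteCategory.isIso_iff_bijective _).mp inferInstance
  have h2 : Function.Bijective (fun ω : M ⟶ (Scheme.Modules.pushforward f).obj
      ((Scheme.Modules.pushforward V.ι).obj N) ↦ ω.app U e) := by
    rw [← hα.of_comp_iff']
    have h3 : Function.Bijective (fun ω : M ⟶ (Scheme.Modules.pushforward f).obj
        ((Scheme.Modules.pushforward V.ι).obj N) ↦ ω ≫ α.hom) :=
      ((isIso_iff_yoneda_map_bijective α.hom).mp inferInstance) M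
    have h4 := (he ((Scheme.Modules.pushforward (f ∣_ U)).obj N)).comp h3
    exact h4
  exact h2.comp ((Scheme.Modules.pullbackPushforwardAdjunction f).homEquiv M _).bijective

end Triv

/-! ### Coordinates of sections under pullback, restriction and change of trivialization -/

section PullbackSection

variable {X Y : Scheme.{u}} (f : Y ⟶ X) (M : X.Modules)

theorem pullbackSection_smul {U : X.Opens} (r : Γ(X, U)) (s : Γ(M, U)) :
    pullbackSection f M (r • s) = f.app U r • pullbackSection f M s :=
  ((Scheme.Modules.pullbackPushforwardAdjunction f).unit.app M).app_smul r s

theorem pullbackSection_res {U V : X.Opens} (h : V ≤ U) (s : Γ(M, U)) :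
    pullbackSection f M (res M h s) = res _ (f.preimage_mono h) (pullbackSection f M s) :=
  app_res ((Scheme.Modules.pullbackPushforwardAdjunction f).unit.app M) h s

theorem LocalTriv.isGenerator {M : X.Modules} {x : X} (t : LocalTriv M x) : IsGenerator M t.e :=
  t.bijective

/-- The pullback of a local trivialization. -/
def LocalTriv.pullback {M : X.Modules} {y : Y} (t : LocalTriv M (f y)) :
    LocalTriv ((Scheme.Modules.pullback f).obj M) y where
  U := f ⁻¹ᵁ t.U
  mem := t.mem
  e := pullbackSection f M t.e
  bijective := t.isGenerator.pullback f

theorem IsLineBundle.pullback {M : X.Modules} (hM : IsLineBundle M) :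
    IsLineBundle ((Scheme.Modules.pullback f).obj M) :=
  fun y ↦ ⟨(hM (f y)).some.pullback f⟩

theorem LocalTriv.coord_pullback {M : X.Modules} {y : Y} (t : LocalTriv M (f y)) {V : X.Opens}
    (h : V ≤ t.U) (s : Γ(M, V)) :
    (t.pullback f).coord (V := f ⁻¹ᵁ V) (f.preimage_mono h) (pullbackSection f M s) =
      f.app V (t.coord h s) := by
  apply coord_eq
  refine Eq.trans ?_ (congrArg (pullbackSection f M) (t.coord_smul h s))
  rw [pullbackSection_smul, pullbackSection_res]
  rfl

theorem LocalTriv.coord_eq_zero_iff {M : X.Modules} {x : X} (t : LocalTriv M x) {V : X.Opens}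
    (h : V ≤ t.U) (s : Γ(M, V)) : t.coord h s = 0 ↔ s = 0 := by
  constructor
  · intro h0
    rw [← t.coord_smul h s, h0, zero_smul]
  · rintro rfl
    exact t.coord_eq h (zero_smul _ _)

theorem LocalTriv.coord_res {M : X.Modules} {x : X} (t : LocalTriv M x) {V W : X.Opens}
    (h : V ≤ t.U) (h' : W ≤ V) (s : Γ(M, V)) :
    t.coord (h'.trans h) (CurveCode.res M h' s) = X.presheaf.map (homOfLE h').op (t.coord h s) := by
  apply coord_eq
  conv_rhs => rw [← t.coord_smul h s]
  rw [res_smul, res_res]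

theorem LocalTriv.coord_smul_eq {M : X.Modules} {x : X} (t : LocalTriv M x) {V : X.Opens}
    (h : V ≤ t.U) (r : Γ(X, V)) (s : Γ(M, V)) : t.coord h (r • s) = r * t.coord h s := by
  apply coord_eq
  rw [mul_smul, t.coord_smul]

/-- Whether a section is invertible at a point does not depend on the trivialization. -/
theorem isUnit_germ_coord {M : X.Modules} {s : Γ(M, ⊤)} {p : X} (t t' : LocalTriv M p)
    (h : IsUnit (X.presheaf.germ t.U p t.mem (t.coord le_rfl (res M le_top s)))) :
    IsUnit (X.presheaf.germ t'.U p t'.mem (t'.coord le_rfl (res M le_top s))) := by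
  let W := t.U ⊓ t'.U
  have hW : p ∈ W := ⟨t.mem, t'.mem⟩
  have e1 : X.presheaf.germ t.U p t.mem (t.coord le_rfl (res M le_top s)) =
      X.presheaf.germ W p hW (t.coord inf_le_left (res M le_top s)) := by
    rw [← res_res M (le_top : t.U ≤ ⊤) (inf_le_left : W ≤ t.U), t.coord_res le_rfl inf_le_left]
    exact (X.presheaf.germ_res_apply (homOfLE inf_le_left) _ hW _).symm
  have e2 : X.presheaf.germ t'.U p t'.mem (t'.coord le_rfl (res M le_top s)) =
      X.presheaf.germ W p hW (t'.coord inf_le_right (res M le_top s)) := by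
    rw [← res_res M (le_top : t'.U ≤ ⊤) (inf_le_right : W ≤ t'.U), t'.coord_res le_rfl inf_le_right]
    exact (X.presheaf.germ_res_apply (homOfLE inf_le_right) _ hW _).symm
  -- The last factor is the transition function. A factor of a unit is a unit, so its own
  -- invertibility is not needed.
  have e3 : t.coord inf_le_left (res M le_top s) = t'.coord inf_le_right (res M le_top s) *
      t.coord (V := W) inf_le_left (res M inf_le_right t'.e) := by
    rw [← t.coord_smul_eq, t'.coord_smul]
  rw [e1, e3, map_mul] at h
  rw [e2]
  exact isUnit_of_mul_isUnit_left h

end PullbackSection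

/-! ### Orders of global sections on an integral scheme -/

section Integral

variable {C : Scheme.{u}} [IsIntegral C]

/-- In a trivialization the section is a function on an integral scheme, determined by its
restriction to any nonempty open; every trivializing open meets `V` by irreducibility. -/
theorem eq_zero_of_res_eq_zero {M : C.Modules} (hM : IsLineBundle M) {V W : C.Opens} (h : V ≤ W)
    (hV : (V : Set C).Nonempty) (s : Γ(M, W)) (hs : res M h s = 0) : s = 0 := by
  have hloc (q : W) : ∃ (U : C.Opens) (i : U ≤ W), q.1 ∈ U ∧ res M i s = 0 := by
    obtain ⟨t⟩ := hM q.1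
    refine ⟨t.U ⊓ W, inf_le_right, ⟨t.mem, q.2⟩, ?_⟩
    rw [← LocalTriv.coord_eq_zero_iff t inf_le_left]
    have hne : Nonempty (t.U ⊓ W ⊓ V : C.Opens) := by
      obtain ⟨x, hx⟩ := nonempty_preirreducible_inter (t.U ⊓ W).isOpen V.isOpen
        ⟨q.1, t.mem, q.2⟩ hV
      exact ⟨⟨x, hx⟩⟩
    apply map_injective_of_isIntegral C
      (homOfLE (inf_le_left : t.U ⊓ W ⊓ V ≤ t.U ⊓ W))
    rw [map_zero, ← t.coord_res inf_le_left inf_le_left, LocalTriv.coord_eq_zero_iff, res_res,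
      ← res_res M h inf_le_right, hs, res_zero]
  choose U i hq hz using hloc
  refine TopCat.Sheaf.eq_of_locally_eq' ⟨M.presheaf, M.isSheaf⟩ U W (fun q ↦ homOfLE (i q)) ?_ _ _
    fun q ↦ (hz q).trans (res_zero M (i q)).symm
  intro x hx
  exact Opens.mem_iSup.mpr ⟨⟨x, hx⟩, hq _⟩

theorem coord_ne_zero {M : C.Modules} (hM : IsLineBundle M) {s : Γ(M, ⊤)} (hs : s ≠ 0) {p : C}
    (t : LocalTriv M p) {V : C.Opens} (h : V ≤ t.U) (hV : (V : Set C).Nonempty) :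
    t.coord h (res M le_top s) ≠ 0 := by
  rw [Ne, LocalTriv.coord_eq_zero_iff]
  exact fun h0 ↦ hs (eq_zero_of_res_eq_zero hM le_top hV s h0)

/-- A global section as a rational section. -/
abbrev RatSection.ofGlobal {M : C.Modules} (s : Γ(M, ⊤)) (hs : s ≠ 0) : RatSection M where
  V := ⊤
  nonempty := ⟨genericPoint C, trivial⟩
  s := s
  ne_zero := hs

/-- In the order on points the generic point is the top, so coheight is codimension. Coheight `0`
would make the closed point `q` generic, hence `C` a single point of dimension `0`. -/
theorem coheight_eq_one_of_isClosed (hdim : topologicalKrullDim C = 1) {q : C}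
    (hq : IsClosed {q}) : Order.coheight q = 1 := by
  refine le_antisymm ?_ (Order.one_le_iff_pos.mpr (Order.coheight_pos.mpr fun hm ↦ ?_))
  · rw [← Order.coheight_orderIso (irreducibleSetEquivPoints (α := C)).symm q]
    have := Order.coheight_le_krullDim ((irreducibleSetEquivPoints (α := C)).symm q)
    rw [topologicalKrullDim] at hdim
    rw [hdim] at this
    exact_mod_cast this
  · have h1 : q ⤳ genericPoint C :=
      hm (Scheme.le_iff_specializes.mpr (genericPoint_specializes _))
    have h2 : ∀ y : C, y = q := fun y ↦ by
      have := (h1.trans (genericPoint_specializes y)).mem_closed hq rfl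
      exact this
    have : Subsingleton C := ⟨fun a b ↦ (h2 a).trans (h2 b).symm⟩
    have h3 := topologicalKrullDim_zero_of_discreteTopology C
    rw [hdim] at h3
    exact absurd h3 (by decide)

variable [IsLocallyNoetherian C]

theorem ord_germ_nonneg {U : C.Opens} [Nonempty U] {p : C} (hp : p ∈ U) {g : Γ(C, U)} (hg : g ≠ 0) :
    0 ≤ Scheme.ord (C.germToFunctionField U g) p := by
  have h1 : Scheme.ord (1 : C.functionField) p = 0 := by
    have := Scheme.ord_of_isUnit (isUnit_one (M := Γ(C, U))) hp
    rwa [map_one] at this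
  have := Scheme.ord_le_smul hp hg (1 : C.functionField)
  rwa [h1, Algebra.smul_def, mul_one] at this

/-- The order is the length of the stalk modulo `g`: finite because the stalk has dimension at most
one, and zero only if `g` is a unit. -/
theorem one_le_ord_germ {U : C.Opens} [Nonempty U] {p : C} (hp : p ∈ U) (hp1 : Order.coheight p = 1)
    {g : Γ(C, U)} (hg : g ≠ 0) (hgp : ¬ IsUnit (C.presheaf.germ U p hp g)) :
    1 ≤ Scheme.ord (C.germToFunctionField U g) p := by
  have hg0 : C.presheaf.germ U p hp g ≠ 0 :=
    (map_ne_zero_iff _ (germ_injective_of_isIntegral C p hp)).mpr hg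
  have : Ring.KrullDimLE 1 (C.presheaf.stalk p) := krullDimLE_of_coheight_le hp1.le
  rw [Scheme.le_ord_iff hp1 ((map_ne_zero_iff _ (Scheme.germToFunctionField_injective C U)).mpr hg),
    ← Scheme.algebraMap_germ_eq_germToFunctionField _ hp]
  change _ ≤ Ring.ordFrac (C.presheaf.stalk p) _
  have hnz := mem_nonZeroDivisors_of_ne_zero hg0
  rw [Ring.ordFrac_eq_ord _ hg0]
  obtain ⟨n, hn⟩ := ENat.ne_top_iff_exists.mp (Ring.ord_ne_top hnz)
  rw [Ring.ordMonoidWithZeroHom_eq_coe _ hnz hn.symm, WithZero.coe_le_coe, Multiplicative.ofAdd_le]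
  have : n ≠ 0 := by
    rintro rfl
    rw [Nat.cast_zero, eq_comm, Ring.ord, Module.length_eq_zero_iff,
      Submodule.Quotient.subsingleton_iff, Ideal.span_singleton_eq_top] at hn
    exact hgp hn
  omega

theorem ordAt_ofGlobal {M : C.Modules} (hM : IsLineBundle M) {s : Γ(M, ⊤)} (hs : s ≠ 0) (p : C) :
    ∃ (t : LocalTriv M p) (_ : Nonempty t.U), (RatSection.ofGlobal s hs).ordAt p =
      Scheme.ord (C.germToFunctionField t.U (t.coord le_rfl (res M le_top s))) p := by
  have h := hM p
  have : Nonempty h.some.U := ⟨⟨p, h.some.mem⟩⟩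
  refine ⟨h.some, this, ?_⟩
  rw [RatSection.ordAt, dif_pos h]
  congr 1
  rw [RatSection.localFunction, Scheme.germToFunctionField]
  have : res M inf_le_right s = res M (inf_le_left : h.some.U ⊓ ⊤ ≤ _) (res M le_top s) :=
    (res_res ..).symm
  change C.presheaf.germ (h.some.U ⊓ ⊤) _ _ (h.some.coord inf_le_left (res M inf_le_right s)) = _
  rw [this, h.some.coord_res le_rfl inf_le_left]
  exact C.presheaf.germ_res_apply (homOfLE inf_le_left) _ _ _

theorem ordAt_ofGlobal_nonneg {M : C.Modules} (hM : IsLineBundle M) {s : Γ(M, ⊤)} (hs : s ≠ 0)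
    (p : C) : 0 ≤ (RatSection.ofGlobal s hs).ordAt p := by
  obtain ⟨t, ht, h⟩ := ordAt_ofGlobal hM hs p
  rw [h]
  exact ord_germ_nonneg t.mem (coord_ne_zero hM hs t le_rfl ⟨p, t.mem⟩)

theorem one_le_ordAt_ofGlobal {M : C.Modules} (hM : IsLineBundle M) {s : Γ(M, ⊤)} (hs : s ≠ 0)
    {p : C} (hp1 : Order.coheight p = 1) (t : LocalTriv M p) (h0 : t.value s = 0) :
    1 ≤ (RatSection.ofGlobal s hs).ordAt p := by
  obtain ⟨t', ht', h⟩ := ordAt_ofGlobal hM hs p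
  rw [h]
  refine one_le_ord_germ t'.mem hp1 (coord_ne_zero hM hs t' le_rfl ⟨p, t'.mem⟩) fun hu ↦ ?_
  -- `ordAt` uses its own chosen trivialization `t'`; a unit there is a unit in `t`, so its residue,
  -- the value in `t`, would be nonzero.
  exact (isUnit_germ_coord t' t hu |>.map (C.residue p).hom).ne_zero h0

/-- A nonzero section is invertible at the generic point, hence on a nonempty basic open. -/
theorem exists_open_ordAt_eq_zero {M : C.Modules} (hM : IsLineBundle M) {s : Γ(M, ⊤)}
    (hs : s ≠ 0) : ∃ D : C.Opens, (D : Set C).Nonempty ∧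
      ∀ p ∈ D, (RatSection.ofGlobal s hs).ordAt p = 0 := by
  obtain ⟨t⟩ := hM (genericPoint C)
  let g := t.coord le_rfl (res M le_top s)
  have hne : Nonempty t.U := ⟨⟨_, t.mem⟩⟩
  have hg : g ≠ 0 := coord_ne_zero hM hs t le_rfl ⟨_, t.mem⟩
  refine ⟨C.basicOpen g, ⟨genericPoint C, ?_⟩, fun p hp ↦ ?_⟩
  · refine (C.mem_basicOpen g _ t.mem).mpr ?_
    exact ((map_ne_zero_iff _ (Scheme.germToFunctionField_injective C t.U)).mpr hg).isUnit
  · have hpU : p ∈ t.U := C.basicOpen_le g hp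
    let t₁ : LocalTriv M p := ⟨t.U, hpU, t.e, t.bijective⟩
    have h1 : IsUnit (C.presheaf.germ t₁.U p t₁.mem (t₁.coord le_rfl (res M le_top s))) :=
      (C.mem_basicOpen g _ hpU).mp hp
    obtain ⟨t', ht', h⟩ := ordAt_ofGlobal hM hs p
    have h2 := isUnit_germ_coord t₁ t' h1
    rw [h]
    obtain ⟨V, i, hpV, hV⟩ : ∃ (V : C.Opens) (i : V ≤ t'.U), p ∈ V ∧
        IsUnit (C.presheaf.map (homOfLE i).op (t'.coord le_rfl (res M le_top s))) :=
      ⟨C.basicOpen _, C.basicOpen_le _, (C.mem_basicOpen _ _ t'.mem).mpr h2,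
        RingedSpace.isUnit_res_basicOpen _ _⟩
    have : Nonempty V := ⟨⟨p, hpV⟩⟩
    have h3 := Scheme.ord_of_isUnit hV hpV
    rw [Scheme.germToFunctionField] at h3 ⊢
    rwa [TopCat.Presheaf.germ_res_apply] at h3

/-- The complement has finitely many irreducible components. A point of coheight one in it must be
the generic point of its component: otherwise that generic point, itself below the generic point of
`C`, would give a chain of length two. -/
theorem finite_coheight_eq_one_compl [CompactSpace C] {D : C.Opens} (hD : (D : Set C).Nonempty) :
    {p : C | Order.coheight p = 1 ∧ p ∉ D}.Finite := by
  have : IsNoetherian C := {}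
  obtain ⟨T, hTf, hTc, hTi, hT⟩ := NoetherianSpace.exists_finite_set_isClosed_irreducible
    D.isOpen.isClosed_compl
  have hgen (t : T) : ∃ x : C, IsGenericPoint x t.1 := QuasiSober.sober (hTi _ t.2) (hTc _ t.2)
  choose x hx using hgen
  have := hTf.to_subtype
  refine (Set.finite_range x).subset fun p ⟨hp1, hpD⟩ ↦ ?_
  obtain ⟨t, ht, hpt⟩ : p ∈ ⋃₀ T := hT ▸ hpD
  refine ⟨⟨t, ht⟩, ?_⟩
  have hle : x ⟨t, ht⟩ ⤳ p := (hx ⟨t, ht⟩).specializes hpt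
  have hxD : x ⟨t, ht⟩ ∉ D := by
    have : x ⟨t, ht⟩ ∈ ⋃₀ T := ⟨t, ht, (hx ⟨t, ht⟩).mem⟩
    rw [← hT] at this
    exact this
  have hmax : ¬ IsMax (x ⟨t, ht⟩) := fun hm ↦ by
    have h1 : x ⟨t, ht⟩ ⤳ genericPoint C :=
      hm (Scheme.le_iff_specializes.mpr (genericPoint_specializes _))
    exact hxD (h1.mem_open D.isOpen
      (((genericPoint_spec C).mem_open_set_iff D.isOpen).mpr (by simpa using hD)))
  by_contra hne
  have hlt : p < x ⟨t, ht⟩ := lt_of_le_not_ge hle fun h ↦ hne (hle.antisymm h).eq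
  have h2 := Order.coheight_add_one_le hlt
  rw [hp1] at h2
  have h3 := Order.coheight_pos.mpr hmax
  have h4 : (1 : ℕ∞) + 1 ≤ 1 := (add_le_add_left (Order.one_le_iff_pos.mpr h3) 1).trans h2
  exact absurd h4 (by decide)

/-- Without finiteness the `finsum` defining the degree would default to `0`. Points of coheight
other than one contribute nothing, by the convention in `Scheme.ord`. -/
theorem finite_support_ordAt [CompactSpace C] {M : C.Modules} (hM : IsLineBundle M) {s : Γ(M, ⊤)}
    (hs : s ≠ 0) : (Function.support (RatSection.ofGlobal s hs).ordAt).Finite := by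
  obtain ⟨D, hD, h⟩ := exists_open_ordAt_eq_zero hM hs
  refine (finite_coheight_eq_one_compl hD).subset fun p hp ↦ ⟨?_, fun hpD ↦ hp (h p hpD)⟩
  obtain ⟨t', ht', h'⟩ := ordAt_ofGlobal hM hs p
  by_contra hc
  exact hp (by rw [h', Scheme.ord_eq_zero_of_coheight_neq_one hc])

end Integral

/-! ### Finiteness of projective schemes, and residue fields of rational points -/

section RationalPoints

variable {k : Type u} [Field k]

theorem surjective_algebraMap_homogeneousSubmodule_zero (m : ℕ) : Function.Surjective
    (algebraMap k (MvPolynomial.homogeneousSubmodule (Fin (m + 1)) k 0)) := by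
  rintro ⟨p, hp⟩
  exact ⟨p.coeff 0, Subtype.ext (MvPolynomial.totalDegree_eq_zero_iff_eq_C.mp
    (Nat.le_zero.mp (MvPolynomial.IsHomogeneous.totalDegree_le hp))).symm⟩

attribute [local instance] MvPolynomial.gradedAlgebra

theorem locallyOfFiniteType_and_quasiCompact_projSpaceHom (m : ℕ) :
    LocallyOfFiniteType (projSpaceHom k m) ∧ QuasiCompact (projSpaceHom k m) := by
  let A := MvPolynomial.homogeneousSubmodule (Fin (m + 1)) k
  have : IsScalarTower k (A 0) (MvPolynomial (Fin (m + 1)) k) :=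
    ⟨fun c x y ↦ smul_mul_assoc c (x : MvPolynomial (Fin (m + 1)) k) y⟩
  have : Algebra.FiniteType (A 0) (MvPolynomial (Fin (m + 1)) k) :=
    Algebra.FiniteType.of_restrictScalars_finiteType k (A 0) _
  have : IsClosedImmersion (Spec.map (CommRingCat.ofHom (algebraMap k (A 0)))) :=
    IsClosedImmersion.spec_of_surjective _ (surjective_algebraMap_homogeneousSubmodule_zero m)
  unfold projSpaceHom
  exact ⟨inferInstanceAs (LocallyOfFiniteType (Proj.toSpecZero A ≫ _)),
    inferInstanceAs (QuasiCompact (Proj.toSpecZero A ≫ _))⟩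

theorem IsProjective.locallyOfFiniteType {X : Scheme.{u}} (π : X ⟶ Spec (CommRingCat.of k))
    [h : IsProjective π] : LocallyOfFiniteType π := by
  obtain ⟨m, j, hj, rfl⟩ := h.exists_closedImmersion
  have := (locallyOfFiniteType_and_quasiCompact_projSpaceHom (k := k) m).1
  infer_instance

theorem IsProjective.quasiCompact {X : Scheme.{u}} (π : X ⟶ Spec (CommRingCat.of k))
    [h : IsProjective π] : QuasiCompact π := by
  obtain ⟨m, j, hj, rfl⟩ := h.exists_closedImmersion
  have := (locallyOfFiniteType_and_quasiCompact_projSpaceHom (k := k) m).2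
  infer_instance

theorem surjective_residueFieldMap_of_isClosedImmersion {X Y : Scheme.{u}} (f : Y ⟶ X)
    [IsClosedImmersion f] (y : Y) : Function.Surjective (f.residueFieldMap y) := by
  intro a
  obtain ⟨b, rfl⟩ := Y.residue_surjective y a
  obtain ⟨c, rfl⟩ := f.stalkMap_surjective y b
  exact ⟨X.residue (f y) c, ConcreteCategory.congr_hom (Scheme.residue_residueFieldMap f y) c⟩

theorem surjective_residueFieldMap_of_constAt {X : Scheme.{u}} (π : X ⟶ Spec (CommRingCat.of k))
    {x : X} (h : Function.Surjective (constAt π x)) :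
    Function.Surjective (π.residueFieldMap x) := by
  intro a
  obtain ⟨c, rfl⟩ := h a
  exact ⟨_, Scheme.evaluation_naturality_apply π (V := ⊤) x trivial _⟩

/-- On a Jacobson scheme a point is closed iff `Spec κ(x) ⟶ X` is locally of finite type. This can
be tested after composing with `π`, where the map factors through two closed immersions. -/
theorem isClosed_of_surjective_residueFieldMap {X : Scheme.{u}} (π : X ⟶ Spec (CommRingCat.of k))
    [LocallyOfFiniteType π] {x : X} (h : Function.Surjective (π.residueFieldMap x)) :
    IsClosed {x} := by
  have : JacobsonSpace X := LocallyOfFiniteType.jacobsonSpace π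
  rw [isClosed_singleton_iff_locallyOfFiniteType]
  have h1 : IsClosedImmersion (Spec.map (π.residueFieldMap x)) :=
    IsClosedImmersion.spec_of_surjective _ h
  have h2 : IsClosedImmersion ((Spec (CommRingCat.of k)).fromSpecResidueField (π x)) :=
    isClosed_singleton_iff_isClosedImmersion.mp
      (@isClosed_discrete _ _ (inferInstanceAs (DiscreteTopology (PrimeSpectrum k))) _)
  have h3 : LocallyOfFiniteType (X.fromSpecResidueField x ≫ π) := by
    rw [← Scheme.Hom.SpecMap_residueFieldMap_fromSpecResidueField]
    infer_instance
  exact locallyOfFiniteType_of_comp _ π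

/-- Surjectivity makes the extension finite, which excludes the default value `0` of `finrank`. -/
theorem residueDegree_pos {X Y : Scheme.{u}} (f : X ⟶ Y) {x : X}
    (h : Function.Surjective (f.residueFieldMap x)) : 0 < f.residueDegree x := by
  let := (f.residueFieldMap x).hom.toAlgebra
  have : Module.Finite (Y.residueField (f x)) (X.residueField x) :=
    Module.Finite.of_surjective (Algebra.linearMap _ _) h
  exact Module.finrank_pos

end RationalPoints

/-! ### Counting rational zeros on a curve -/

theorem LocalTriv.value_pullback {X Y : Scheme.{u}} (f : Y ⟶ X) {M : X.Modules} {y : Y}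
    (t : LocalTriv M (f y)) (s : Γ(M, ⊤)) :
    (t.pullback f).value (pullbackSection f M s) = f.residueFieldMap y (t.value s) := by
  unfold LocalTriv.value
  rw [Scheme.evaluation_naturality_apply f y t.mem, ← t.coord_pullback f le_rfl,
    pullbackSection_res]
  rfl

theorem LocalTriv.value_zero {X : Scheme.{u}} {M : X.Modules} {x : X} (t : LocalTriv M x) :
    t.value (0 : Γ(M, ⊤)) = 0 := by
  simpa using t.value_add 0 0

/-- A section of a line bundle that does not vanish identically on a curve has at most
`deg (L|_C)` rational zeros on the curve. -/
theorem card_zeros_le_intersectionNumber {k : Type u} [Field k] {X : Scheme.{u}}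
    (π : X ⟶ Spec (CommRingCat.of k)) [IsProjective π] {L : X.Modules} (hL : IsLineBundle L)
    (C : Curve X) {f : Γ(L, ⊤)} (hf : ¬ C.support ⊆ zeroLocus L f) (T : Finset X)
    (hT : (T : Set X) ⊆ rationalPoints π) (hTC : (T : Set X) ⊆ C.support)
    (hTf : ∀ P ∈ T, ∃ t : LocalTriv L P, t.value f = 0) :
    ((T.card : ℝ) : EReal) ≤ intersectionNumber π L C := by
  have := C.isIntegral
  have := C.isClosedImmersion
  have := IsProjective.isLocallyNoetherian π
  have := C.isLocallyNoetherian
  have := IsProjective.locallyOfFiniteType π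
  have := IsProjective.quasiCompact π
  have hcomp : CompactSpace C.C := QuasiCompact.compactSpace_of_compactSpace (C.ι ≫ π)
  have hM := hL.pullback C.ι
  let s : Γ((Scheme.Modules.pullback C.ι).obj L, ⊤) := pullbackSection C.ι L f
  -- Residue field maps are injective, so `s = 0` would force `f` to vanish at every point of the
  -- curve, in every trivialization.
  have hs : s ≠ 0 := by
    intro h0
    apply hf
    rintro _ ⟨q, rfl⟩ t
    have h1 := t.value_pullback C.ι f
    change LocalTriv.value _ s = _ at h1
    rw [h0, LocalTriv.value_zero] at h1
    exact (map_eq_zero _).mp h1.symm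
  have hι : Function.Injective C.ι := C.ι.isClosedEmbedding.injective
  let T' : Finset C.C := T.preimage C.ι hι.injOn
  have hcard : T'.card = T.card := by
    classical
    rw [← Finset.card_image_of_injective T' hι, Finset.image_preimage_of_bij]
    exact ⟨fun x hx ↦ hx, hι.injOn, fun x hx ↦ by
      obtain ⟨q, rfl⟩ := hTC hx
      exact ⟨q, hx, rfl⟩⟩
  have hsurj : ∀ q ∈ T', Function.Surjective ((C.ι ≫ π).residueFieldMap q) := by
    intro q hq
    rw [Scheme.residueFieldMap_comp]
    exact (surjective_residueFieldMap_of_isClosedImmersion C.ι q).comp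
      (surjective_residueFieldMap_of_constAt π (hT (Finset.mem_preimage.mp hq)).2)
  have hterm : ∀ q ∈ T', (1 : ℤ) ≤ (RatSection.ofGlobal s hs).ordAt q *
      ((C.ι ≫ π).residueDegree q : ℤ) := by
    intro q hq
    obtain ⟨t, ht⟩ := hTf _ (Finset.mem_preimage.mp hq)
    have h1 := one_le_ordAt_ofGlobal hM hs (coheight_eq_one_of_isClosed C.dim_eq_one
      (isClosed_of_surjective_residueFieldMap _ (hsurj q hq))) (t.pullback C.ι)
      (by rw [t.value_pullback, ht, map_zero])
    have h2 : (1 : ℤ) ≤ (C.ι ≫ π).residueDegree q := by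
      exact_mod_cast residueDegree_pos _ (hsurj q hq)
    nlinarith
  have hdeg : (T.card : ℤ) ≤ (RatSection.ofGlobal s hs).degree (C.ι ≫ π) := by
    classical
    rw [RatSection.degree, finsum_eq_sum_of_support_subset
      (s := (finite_support_ordAt hM hs).toFinset ∪ T')]
    · calc (T.card : ℤ) = ∑ q ∈ T', (1 : ℤ) := by simp [hcard]
        _ ≤ ∑ q ∈ T', (RatSection.ofGlobal s hs).ordAt q * ((C.ι ≫ π).residueDegree q : ℤ) :=
          Finset.sum_le_sum hterm
        _ ≤ _ := Finset.sum_le_sum_of_subset_of_nonneg Finset.subset_union_right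
          fun q _ _ ↦ mul_nonneg (ordAt_ofGlobal_nonneg hM hs q) (Nat.cast_nonneg _)
    · intro q hq
      simp only [Finset.coe_union, Set.Finite.coe_toFinset]
      exact Or.inl (left_ne_zero_of_mul hq)
  -- The degree is a supremum over rational sections, so this one section already bounds it from
  -- below.
  refine le_trans ?_ (le_iSup (fun s : RatSection ((Scheme.Modules.pullback C.ι).obj L) ↦
    (((s.degree (C.ι ≫ π) : ℤ) : ℝ) : EReal)) (RatSection.ofGlobal s hs))
  exact EReal.coe_le_coe_iff.mpr (by exact_mod_cast hdeg)

end

end CurveCode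

/-! ### The minimum distance bound -/

theorem theorem3p3 {k : Type u} [Field k] [Finite k] {X : Scheme.{u}}
    (π : X ⟶ Spec (CommRingCat.of k)) [CurveCode.IsProjective π] [IsIntegral X]
    [CurveCode.IsNormal X] (hdim : 2 ≤ topologicalKrullDim X)
    (S : Finset X) (hS : (S : Set X) ⊆ CurveCode.rationalPoints π)
    {a : ℕ} (C : Fin a → CurveCode.Curve X) (hSC : (S : Set X) ⊆ ⋃ i, (C i).support)
    (N η : ℝ) (hN : ∀ i, (((C i).support ∩ (S : Set X)).ncard : ℝ) ≤ N)
    (L : X.Modules) (hL : CurveCode.IsLineBundle L)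
    (hLC : ∀ i, 0 ≤ CurveCode.intersectionNumber π L (C i) ∧
      CurveCode.intersectionNumber π L (C i) ≤ (η : EReal))
    (hηN : η ≤ N)
    (ℓ : ℕ)
    (hℓ : IsGreatest {n : ℕ | ∃ f : Γ(L, ⊤), f ≠ 0 ∧
      {i | (C i).support ⊆ CurveCode.zeroLocus L f}.ncard = n} ℓ)
    (t : ∀ P : S, CurveCode.LocalTriv L P.1)
    (d : ℕ) (hd : CurveCode.IsMinDist (CurveCode.code π L S hS t) d) :
    (S.card : ℝ) - ℓ * N - (a - ℓ) * η ≤ d := by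
  classical
  obtain ⟨⟨c, ⟨f₁, rfl⟩, c', ⟨f₂, rfl⟩, hne, hdist⟩, -⟩ := hd
  obtain ⟨f, rfl⟩ : ∃ f, f₁ = f + f₂ := ⟨f₁ - f₂, (sub_add_cancel _ _).symm⟩
  have hf : f ≠ 0 := by
    rintro rfl
    exact hne (by rw [zero_add])
  have hval (P : S) : CurveCode.germMap π L S hS t (f + f₂) P = CurveCode.germMap π L S hS t f₂ P ↔
      (t P).value f = 0 := by
    rw [CurveCode.germMap, CurveCode.germMap, (CurveCode.toBase π (hS P.2)).injective.eq_iff,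
      CurveCode.LocalTriv.value_add, add_eq_right]
  let I : Finset (Fin a) := {i | (C i).support ⊆ CurveCode.zeroLocus L f}
  -- This uses that `ℓ` is an upper bound, with `f ≠ 0`.
  have hI : I.card ≤ ℓ := hℓ.2 ⟨f, hf, by rw [← Set.ncard_coe_finset]; simp [I]⟩
  let Z : Finset X := (Finset.univ.filter fun P : S ↦ (t P).value f = 0).map
    (Function.Embedding.subtype _)
  have hZS : Z ⊆ S := fun P hP ↦ by
    obtain ⟨Q, -, rfl⟩ := Finset.mem_map.mp hP
    exact Q.2
  have hZt : ∀ P ∈ Z, ∃ t : CurveCode.LocalTriv L P, t.value f = 0 := fun P hP ↦ by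
    obtain ⟨Q, hQ, rfl⟩ := Finset.mem_map.mp hP
    exact ⟨t Q, (Finset.mem_filter.mp hQ).2⟩
  have hcard : S.card = Z.card + d := by
    have h := Finset.card_filter_add_card_filter_not (s := (Finset.univ : Finset S))
      (fun P ↦ (t P).value f = 0)
    rw [Finset.card_univ, Fintype.card_coe] at h
    rw [← h, Finset.card_map, ← hdist, hammingDist]
    simp only [ne_eq, hval]
  have hbound (i : Fin a) :
      ((Z.filter (· ∈ (C i).support)).card : ℝ) ≤ if i ∈ I then N else η := by
    split_ifs with hi
    · refine le_trans ?_ (hN i)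
      rw [← Set.ncard_coe_finset]
      refine Nat.cast_le.mpr (Set.ncard_le_ncard (fun P hP ↦ ?_) (S.finite_toSet.inter_of_right _))
      have hP' := Finset.mem_filter.mp hP
      exact ⟨hP'.2, hZS hP'.1⟩
    · have := CurveCode.card_zeros_le_intersectionNumber π hL (C i) (f := f) (by simpa [I] using hi)
        (Z.filter (· ∈ (C i).support))
        (fun P hP ↦ hS (hZS (Finset.mem_filter.mp hP).1))
        (fun P hP ↦ (Finset.mem_filter.mp hP).2)
        (fun P hP ↦ hZt P (Finset.mem_filter.mp hP).1)
      exact EReal.coe_le_coe_iff.mp (this.trans (hLC i).2)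
  -- The curves may overlap, so this is only a union bound.
  have hZ : Z.card ≤ ∑ i, (Z.filter (· ∈ (C i).support)).card := by
    refine (Finset.card_le_card fun P hP ↦ ?_).trans Finset.card_biUnion_le
    obtain ⟨i, hi⟩ := Set.mem_iUnion.mp (hSC (hZS hP))
    exact Finset.mem_biUnion.mpr ⟨i, Finset.mem_univ _, Finset.mem_filter.mpr ⟨hP, hi⟩⟩
  have hsum : (Z.card : ℝ) ≤ I.card * N + (a - I.card) * η := by
    calc (Z.card : ℝ) ≤ ∑ i, ((Z.filter (· ∈ (C i).support)).card : ℝ) := by exact_mod_cast hZ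
      _ ≤ ∑ i, if i ∈ I then N else η := Finset.sum_le_sum fun i _ ↦ hbound i
      _ = I.card * N + (a - I.card) * η := by
        have (i : Fin a) : (if i ∈ I then N else η) = (if i ∈ I then N - η else 0) + η := by
          split_ifs <;> ring
        simp only [this, Finset.sum_add_distrib, Finset.sum_ite_mem, Finset.univ_inter,
          Finset.sum_const, Finset.card_univ, Fintype.card_fin, nsmul_eq_mul]
        ring
  have hI' : (I.card : ℝ) ≤ ℓ := Nat.cast_le.mpr hI
  have hS' : (S.card : ℝ) = Z.card + d := by exact_mod_cast hcard
  -- Passing from `#I` to `ℓ` changes the bound by `(ℓ - #I)(N - η) ≥ 0`.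
  nlinarith [mul_nonneg (sub_nonneg.mpr hI') (sub_nonneg.mpr hηN)]
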